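/- For a group $G$, let $$S(G) := \{x \in G : x^{|G:H|} \in H \text{ for every subgroup } H \leqslant G \text{ of finite index}\}.$$ If $F$ is a finitely generated free group that is not infinite cyclic (that is, of rank different from $1$), then $S(F) = 1$, that is, $S(F)=\{1\}$. -/

import Mathlib

/-- The set `S(G)` of the elements `x` of a group `G` such that `x ^ |G : H| ∈ H` for every
subgroup `H` of finite index in `G`. -/
def groupS (G : Type*) [Group G] : Set G :=
  {x : G | ∀ H : Subgroup G, H.FiniteIndex → x ^ H.index ∈ H}

/-!
Let `x ≠ 1` be an element of a free group on at least two letters. A transitive action of the group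
on a set of `n` points, some point of which is moved by `x ^ n`, shows that `x` is not in `S`: the
stabilizer of that point has index `n` (`apply_pow_card_of_mem_groupS`).

Since `S` is invariant under conjugation, `x` may be taken to be represented by a nonempty
cyclically reduced word `w`, of length `m` say. Write `w` twice around a cycle with `2 * m`
vertices. As the labelling has no backtracking, each generator acts on the vertices of the cycle as
a partial injection, and `x` swaps the vertices `0` and `m`. As there are two generators, some
generator is undefined at some vertex of the cycle. Add one vertex, let that generator send that
vertex to the new one, and extend all the partial injections to permutations of the `2 * m + 1`
vertices (`exists_hom_perm_of_cyclic_labelling`). The resulting action is transitive, and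
since `2 * m + 1` is odd, `x ^ (2 * m + 1)` moves `0` to `m`.
-/

/-- A partial injection of a finite type, given by its graph `R`, extends to a permutation. -/
theorem exists_perm_of_partial_injection {α : Type*} [Finite α] (R : α → α → Prop)
    (hfun : ∀ x y z, R x y → R x z → y = z) (hinj : ∀ x y z, R x z → R y z → x = y) :
    ∃ σ : Equiv.Perm α, ∀ x y, R x y → σ x = y := by
  classical
  have := Fintype.ofFinite α
  let f : α → α := fun x => if h : ∃ y, R x y then h.choose else x
  have hf : ∀ x y, R x y → f x = y := by
    intro x y hxy
    have h : ∃ y, R x y := ⟨y, hxy⟩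
    simp only [f, dif_pos h]
    exact hfun _ _ _ h.choose_spec hxy
  obtain ⟨g, hg⟩ := Set.MapsTo.exists_equiv_extend_of_card_eq (α := α) (t := Finset.univ)
    (s := {x | ∃ y, R x y}) (f := f) Finset.card_univ.symm (fun _ _ => by simp) (by
      rintro x ⟨y, hx⟩ x' ⟨y', hx'⟩ h
      rw [hf x y hx, hf x' y' hx'] at h
      subst h
      exact hinj _ _ _ hx hx')
  refine ⟨g.trans (Equiv.subtypeUnivEquiv (by simp)), fun x y hxy => ?_⟩
  rw [← hf x y hxy]
  exact hg x ⟨y, hxy⟩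

/-- The stabilizer of a point in a transitive action has index the number of points, so elements of
`groupS G` satisfy this identity in every finite transitive action. -/
theorem apply_pow_card_of_mem_groupS {G α : Type*} [Group G]
    (φ : G →* Equiv.Perm α) [Finite α] {p : α} (hp : ∀ q, ∃ g, φ g p = q)
    {x : G} (hx : x ∈ groupS G) : (φ x ^ Nat.card α) p = p := by
  let : MulAction G α := MulAction.compHom α φ
  have horb : MulAction.orbit G p = Set.univ := Set.eq_univ_of_forall hp
  have hidx : (MulAction.stabilizer G p).index = Nat.card α := by
    rw [MulAction.index_stabilizer, horb, Set.ncard_univ]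
  have : Nonempty α := ⟨p⟩
  have h := hx (MulAction.stabilizer G p) ⟨by rw [hidx]; exact Nat.card_pos.ne'⟩
  rw [hidx, MulAction.mem_stabilizer_iff] at h
  rw [← map_pow]
  exact h

theorem map_mem_groupS {G K : Type*} [Group G] [Group K] (e : G ≃* K) {x : G}
    (hx : x ∈ groupS G) : e x ∈ groupS K := by
  intro H hH
  have hidx : (H.comap e.toMonoidHom).index = H.index :=
    H.index_comap_of_surjective e.surjective
  have h := hx (H.comap e.toMonoidHom) ⟨by rw [hidx]; exact hH.index_ne_zero⟩
  rw [hidx, Subgroup.mem_comap, map_pow] at h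
  simpa using h

theorem conj_mem_groupS {G : Type*} [Group G] {x : G} (hx : x ∈ groupS G) (g : G) :
    g * x * g⁻¹ ∈ groupS G := by
  simpa using map_mem_groupS (MulAut.conj g) hx

theorem one_mem_groupS (G : Type*) [Group G] : 1 ∈ groupS G := fun H _ => by simp

/-- A cycle whose edges `i + 1 → i` are labelled without backtracking by letters `ℓ i`, together with
one further vertex `none`, carries an action of the free group in which the letter `ℓ i` traverses
the edge `i + 1 → i` and some generator joins the cycle to the further vertex. -/
theorem exists_hom_perm_of_cyclic_labelling {X : Type*} [Nontrivial X] {N : ℕ} [NeZero N]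
    (ℓ : ZMod N → X × Bool)
    (hℓ : ∀ i, (ℓ i).1 = (ℓ (i + 1)).1 → (ℓ i).2 = (ℓ (i + 1)).2) :
    ∃ φ : FreeGroup X →* Equiv.Perm (Option (ZMod N)),
      (∀ i, φ (FreeGroup.mk [ℓ i]) (some (i + 1)) = some i) ∧
      ∃ g v, φ g (some v) = none := by
  -- The generator `c` is not defined at the vertex `v`. If two generators were defined everywhere,
  -- each of the two edges at `i + 1` would serve one of them, making `ℓ i` positive and `ℓ (i + 1)`
  -- negative for every `i`, which is absurd.
  obtain ⟨c, v, hc₁, hc₂⟩ : ∃ (c : X) (v : ZMod N),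
      (∀ i, ℓ i = (c, true) → i + 1 ≠ v) ∧ ℓ v ≠ (c, false) := by
    obtain ⟨a, b, hab⟩ := exists_pair_ne X
    by_contra! hcon
    have key : ∀ i, (ℓ (i + 1)).2 = false ∧ (ℓ i).2 = true := by
      intro i
      have ha := hcon a (i + 1)
      have hb := hcon b (i + 1)
      by_cases h1 : ℓ i = (a, true)
      · have h2 : ℓ (i + 1) = (b, false) := hb fun j hj hji => by
          rw [add_right_cancel hji, h1] at hj
          exact hab (congrArg Prod.fst hj)
        simp [h1, h2]
      · have h2 : ℓ (i + 1) = (a, false) := ha fun j hj hji => h1 (add_right_cancel hji ▸ hj)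
        by_cases h3 : ℓ i = (b, true)
        · simp [h3, h2]
        · have h4 : ℓ (i + 1) = (b, false) := hb fun j hj hji => h3 (add_right_cancel hji ▸ hj)
          rw [h2] at h4
          exact absurd (congrArg Prod.fst h4) hab
    have h1 := (key 0).1
    have h2 := (key (0 + 1)).2
    rw [h1] at h2
    exact Bool.noConfusion h2
  -- `R a` is the partial injection by which the generator `a` is to act.
  let R : X → Option (ZMod N) → Option (ZMod N) → Prop := fun a p q =>
    (∃ i, ℓ i = (a, true) ∧ p = some (i + 1) ∧ q = some i) ∨
    (∃ i, ℓ i = (a, false) ∧ p = some i ∧ q = some (i + 1)) ∨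
    (a = c ∧ p = some v ∧ q = none)
  have hback : ∀ a s i j, ℓ i = (a, s) → ℓ j = (a, !s) → j ≠ i + 1 := by
    rintro a s i j hi hj rfl
    have := hℓ i (by rw [hi, hj])
    rw [hi, hj] at this
    cases s <;> simp at this
  have hR : ∀ a, ∃ σ : Equiv.Perm (Option (ZMod N)), ∀ p q, R a p q → σ p = q := by
    intro a
    apply exists_perm_of_partial_injection
    · rintro p q r (⟨i, hi, rfl, rfl⟩ | ⟨i, hi, rfl, rfl⟩ | ⟨rfl, rfl, rfl⟩)
        (⟨j, hj, h, rfl⟩ | ⟨j, hj, h, rfl⟩ | ⟨h', h, rfl⟩)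
      · simpa using h
      · exact absurd (Option.some.inj h).symm (hback _ _ _ _ hi hj)
      · exact absurd (Option.some.inj h) (hc₁ _ (h' ▸ hi))
      · exact absurd (Option.some.inj h) (hback _ _ _ _ hj hi)
      · simpa using h
      · exact absurd (h' ▸ Option.some.inj h ▸ hi) hc₂
      · exact absurd (Option.some.inj h).symm (hc₁ _ hj)
      · exact absurd (Option.some.inj h ▸ hj) hc₂
      · rfl
    · rintro p q r (⟨i, hi, rfl, rfl⟩ | ⟨i, hi, rfl, rfl⟩ | ⟨rfl, rfl, rfl⟩)
        (⟨j, hj, rfl, h⟩ | ⟨j, hj, rfl, h⟩ | ⟨h', rfl, h⟩)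
      · simpa using h
      · exact absurd (Option.some.inj h) (hback _ _ _ _ hj hi)
      · simp at h
      · exact absurd (Option.some.inj h).symm (hback _ _ _ _ hi hj)
      · simpa using h
      · simp at h
      · simp at h
      · simp at h
      · rfl
  choose σ hσ using hR
  refine ⟨FreeGroup.lift σ, fun i => ?_, FreeGroup.of c, v, ?_⟩
  · rcases hi : ℓ i with ⟨a, _ | _⟩
    · have := hσ a (some i) (some (i + 1)) (Or.inr (Or.inl ⟨i, hi, rfl, rfl⟩))
      simp [← this]
    · simpa using hσ a _ _ (Or.inl ⟨i, hi, rfl, rfl⟩)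
  · simpa using hσ c _ _ (Or.inr (Or.inr ⟨rfl, rfl, rfl⟩))

/-- Cyclically consecutive letters of a cyclically reduced word do not cancel. -/
theorem FreeGroup.IsCyclicallyReduced.getElem_mod {X : Type*} {w : List (X × Bool)}
    (hw : FreeGroup.IsCyclicallyReduced w) (hm : 0 < w.length) (j : ℕ) :
    (w[j % w.length]'(Nat.mod_lt _ hm)).1 = (w[(j + 1) % w.length]'(Nat.mod_lt _ hm)).1 →
    (w[j % w.length]'(Nat.mod_lt _ hm)).2 = (w[(j + 1) % w.length]'(Nat.mod_lt _ hm)).2 := by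
  have hlt := Nat.mod_lt j hm
  rcases Nat.lt_or_ge (j % w.length + 1) w.length with h | h
  · have e : (j + 1) % w.length = j % w.length + 1 := by
      rw [Nat.add_mod_eq_ite, Nat.mod_eq_of_lt (by omega : 1 < w.length), if_neg (by omega)]
    simp only [e]
    exact List.isChain_iff_getElem.mp hw.1 _ h
  · have e1 : j % w.length = w.length - 1 := by omega
    have e : (j + 1) % w.length = 0 := by
      rw [Nat.add_mod, e1, Nat.add_mod_mod, Nat.sub_add_cancel hm, Nat.mod_self]
    simp only [e, e1]
    refine hw.2 _ ?_ _ ?_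
    · rw [List.getLast?_eq_getElem?]; simp
    · rw [List.head?_eq_getElem?]; simp

/-- The case of a cyclically reduced word, to which the general one reduces by conjugation. -/
theorem FreeGroup.mk_notMem_groupS {X : Type*} [Nontrivial X] {w : List (X × Bool)}
    (hw : FreeGroup.IsCyclicallyReduced w) (hne : w ≠ []) :
    FreeGroup.mk w ∉ groupS (FreeGroup X) := by
  intro hS
  have hm : 0 < w.length := List.length_pos_iff.mpr hne
  set m := w.length with hmdef
  have : NeZero (2 * m) := ⟨by omega⟩
  let ℓ : ZMod (2 * m) → X × Bool := fun i => w[i.val % m]'(Nat.mod_lt _ hm)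
  have hℓnat : ∀ j : ℕ, ℓ j = w[j % m]'(Nat.mod_lt _ hm) := by
    intro j
    simp only [ℓ, ZMod.val_natCast, Nat.mod_mul_left_mod]
  obtain ⟨φ, hφ, g, v, hg⟩ := exists_hom_perm_of_cyclic_labelling ℓ (by
    intro i
    obtain ⟨j, rfl⟩ := ZMod.natCast_zmod_surjective i
    rw [← Nat.cast_succ, hℓnat, hℓnat]
    exact hw.getElem_mod hm j)
  -- Each suffix of the copy of `w` between the vertices `s * m` and `s * m + m` takes the end of the
  -- copy to the vertex where the suffix starts.
  have hpath : ∀ s k : ℕ, k ≤ m →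
      φ (FreeGroup.mk (w.drop k)) (some ((s * m + m : ℕ) : ZMod (2 * m))) =
        some ((s * m + k : ℕ) : ZMod (2 * m)) := by
    intro s k hk
    induction hk using Nat.decreasingInduction with
    | self => simp [hmdef, ← FreeGroup.one_eq_mk]
    | of_succ k hk ih =>
      have hd : FreeGroup.mk (w.drop k) =
          FreeGroup.mk [ℓ (s * m + k : ℕ)] * FreeGroup.mk (w.drop (k + 1)) := by
        rw [FreeGroup.mul_mk, hℓnat, List.drop_eq_getElem_cons hk]
        simp [Nat.mod_eq_of_lt hk]
      rw [hd, _root_.map_mul, Equiv.Perm.mul_apply, ih, ← add_assoc, Nat.cast_succ, hφ]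
  have h0 : φ (FreeGroup.mk w) (some (m : ZMod (2 * m))) = some 0 := by
    simpa using hpath 0 0 (Nat.zero_le _)
  have h1 : φ (FreeGroup.mk w) (some 0) = some (m : ZMod (2 * m)) := by
    have h := hpath 1 0 (Nat.zero_le _)
    have e : ((1 * m + m : ℕ) : ZMod (2 * m)) = 0 := by
      rw [one_mul, ← two_mul, ZMod.natCast_self]
    rw [e] at h
    simpa using h
  have htrans : ∀ q, ∃ g, φ g (some 0) = q := by
    have hcyc : ∀ j : ℕ, ∃ g, φ g (some 0) = some (j : ZMod (2 * m)) := by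
      intro j
      induction j with
      | zero => exact ⟨1, by simp⟩
      | succ j ih =>
        obtain ⟨g, hg⟩ := ih
        refine ⟨(FreeGroup.mk [ℓ j])⁻¹ * g, ?_⟩
        rw [_root_.map_mul, Equiv.Perm.mul_apply, hg, _root_.map_inv,
          Equiv.Perm.inv_eq_iff_eq, Nat.cast_succ, hφ]
    rintro (_ | i)
    · obtain ⟨j, rfl⟩ := ZMod.natCast_zmod_surjective v
      obtain ⟨h, hh⟩ := hcyc j
      exact ⟨g * h, by rw [_root_.map_mul, Equiv.Perm.mul_apply, hh, hg]⟩
    · obtain ⟨j, rfl⟩ := ZMod.natCast_zmod_surjective i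
      exact hcyc j
  have hfix := apply_pow_card_of_mem_groupS φ htrans hS
  have hcard : Nat.card (Option (ZMod (2 * m))) = 2 * m + 1 := by
    rw [Finite.card_option, Nat.card_zmod]
  have h2 : (φ (FreeGroup.mk w) ^ 2) (some 0) = some 0 := by
    rw [pow_two, Equiv.Perm.mul_apply, h1, h0]
  rw [hcard, pow_succ', Equiv.Perm.mul_apply, pow_mul,
    Equiv.Perm.pow_apply_eq_self_of_apply_eq_self h2, h1, Option.some_inj,
    ZMod.natCast_eq_zero_iff] at hfix
  exact absurd (Nat.le_of_dvd hm hfix) (by omega)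

theorem FreeGroup.groupS_eq_one {X : Type*} [Nontrivial X] : groupS (FreeGroup X) = {1} := by
  classical
  refine Set.eq_singleton_iff_unique_mem.mpr ⟨one_mem_groupS _, fun x hx => ?_⟩
  set u := FreeGroup.reduceCyclically.conjugator x.toWord
  set w := FreeGroup.reduceCyclically x.toWord
  have hx' : x = FreeGroup.mk u * FreeGroup.mk w * (FreeGroup.mk u)⁻¹ := by
    rw [FreeGroup.inv_mk, FreeGroup.mul_mk, FreeGroup.mul_mk,
      FreeGroup.reduceCyclically.conj_conjugator_reduceCyclically, FreeGroup.mk_toWord]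
  have hwS : FreeGroup.mk w ∈ groupS (FreeGroup X) := by
    have h := conj_mem_groupS hx (FreeGroup.mk u)⁻¹
    have e : (FreeGroup.mk u)⁻¹ * x * (FreeGroup.mk u)⁻¹⁻¹ = FreeGroup.mk w := by
      rw [hx']; group
    rwa [e] at h
  have hw : w = [] := by
    by_contra hne
    exact FreeGroup.mk_notMem_groupS
      (FreeGroup.reduceCyclically.isCyclicallyReduced FreeGroup.isReduced_toWord) hne hwS
  rw [hx', hw, ← FreeGroup.one_eq_mk]
  group

theorem corollary5p8 {F : Type*} [Group F] [IsFreeGroup F] [Group.FG F]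
    (hF : IsEmpty (F ≃* Multiplicative ℤ)) :
    groupS F = {1} := by
  let e := IsFreeGroup.toFreeGroup F
  refine Set.eq_singleton_iff_unique_mem.mpr ⟨one_mem_groupS _, fun x hx => ?_⟩
  apply e.injective
  rw [map_one]
  rcases subsingleton_or_nontrivial (IsFreeGroup.Generators F) with hsub | hnt
  · rcases isEmpty_or_nonempty (IsFreeGroup.Generators F) with hemp | ⟨⟨a⟩⟩
    · exact Subsingleton.elim _ _
    · let : Unique (IsFreeGroup.Generators F) := uniqueOfSubsingleton a
      exact hF.elim (e.trans FreeGroup.mulEquivIntOfUnique)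
  · have h := map_mem_groupS e hx
    rwa [FreeGroup.groupS_eq_one] at h
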